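/- Let $S$ be a separable topological space equipped with a $\sigma$-algebra $\mathcal S$ that contains its Borel sets. Let $\mathcal K$ be a set of bounded continuous kernels on $S \times S$, that is, of bounded continuous functions $k : S \times S \to \mathbb R$ that are symmetric and satisfy $\sum_{i,j} c_i c_j k(x_i, x_j) \ge 0$ for all finite families of points $x_i \in S$ and reals $c_i$. Assume that $(\mathcal K, \lVert \cdot \rVert_\infty)$ is separable. Put $\lVert k \rVert_{\mathrm{diag}} = \sup_{x \in S} k(x,x)$ and $$\mathcal L = \{ k / \lVert k \rVert_{\mathrm{diag}} : k \in \mathcal K \} \cup \{0\}, \qquad D = \sup_{f_1, f_2 \in \mathcal L} \lVert f_1 - f_2 \rVert_\infty,$$ $$J = \left( 162 \int_0^{D/2} \log\bigl( 2 N(a, \mathcal L, \lVert \cdot \rVert_\infty) \bigr) \, da + 1 \right)^{1/2} \in [1, \infty],$$ where $k / \lVert k \rVert_{\mathrm{diag}}$ is read as $0$ if $k = 0$, and $N(a, \mathcal L, \lVert \cdot \rVert_\infty) \in \mathbb N \cup \{\infty\}$ is the minimum size of a set $A \subseteq \mathcal L$ such that every point of $\mathcal L$ is within distance at most $a$ of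 a point of $A$. Let $n \ge 1$, $\sigma \in \mathbb R$, and let $(X_i, \varepsilon_i)$, $1 \le i \le n$, be i.i.d. $S \times \mathbb R$-valued random variables on a probability space $(\Omega, \mathcal F, \mathbb P)$ such that $\varepsilon_i$ is $\sigma^2$-subgaussian given $X_i$: for all $t \in \mathbb R$, $\mathbb E(\exp(t \varepsilon_i) \mid X_i) \le \exp(\sigma^2 t^2/2)$ almost surely. For $f \in \mathcal L$ let $$W(f) = \frac{1}{n^2} \sum_{i,j=1}^n \varepsilon_i \varepsilon_j f(X_i, X_j).$$ For a random variable $Z$ let $\lVert Z \rVert_{\psi_1} = \inf \{ a \in (0,\infty) : \mathbb E(\exp(|Z|/a) - 1) \le 1 \} \in [0,\infty]$. Then $\sup_{f \in \mathcal L} W(f)$ is a (finite, measurable) random variable and $$\left\lVert \sup_{f \in \mathcal L} W(f) \right\rVert_{\psi_1} \le \frac{4 J^2 \sigma^2}{n},$$ where the right-hand side is read in $[0,\infty]$ with $\infty \cdot 0 = 0$. -/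

import Mathlib

open MeasureTheory ProbabilityTheory
open scoped ENNReal BoundedContinuousFunction

namespace KernelChaining

/-- The function `ψ₁ x = exp |x| - 1`. -/
noncomputable def psiOne (x : ℝ) : ℝ := Real.exp |x| - 1

/-- The Orlicz norm `‖Z‖_{ψ₁} = inf {a ∈ (0, ∞) : E ψ₁ (Z / a) ≤ 1}` as an element of `[0, ∞]`,
with the infimum of the empty set equal to `∞`. -/
noncomputable def psiOneNorm {Ω : Type*} [MeasurableSpace Ω] (Z : Ω → ℝ) (μ : Measure Ω) : ℝ≥0∞ :=
  sInf (ENNReal.ofReal ''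
    {a : ℝ | 0 < a ∧ ∫⁻ ω, ENNReal.ofReal (psiOne (Z ω / a)) ∂μ ≤ 1})

/-- `U` is `c`-subgaussian given `V`: `E (exp (t U) | V) ≤ exp (c t² / 2)` almost surely, for all
real `t`. The integrability clause says that the (always defined) conditional expectation of the
nonnegative variable `exp (t U)` agrees with Mathlib's, which is `0` for non-integrable functions;
it follows from the bound on a probability space. -/
structure CondSubgaussian {Ω S : Type*} [MeasurableSpace Ω] [MeasurableSpace S]
    (U : Ω → ℝ) (V : Ω → S) (c : ℝ) (μ : Measure Ω) : Prop where
  integrable_exp : ∀ t : ℝ, Integrable (fun ω => Real.exp (t * U ω)) μ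
  condExp_le : ∀ t : ℝ,
    μ[fun ω => Real.exp (t * U ω) | MeasurableSpace.comap V inferInstance]
      ≤ᵐ[μ] fun _ => Real.exp (c * t ^ 2 / 2)

section Kernels

variable {S : Type*} [TopologicalSpace S]

/-- A bounded continuous function on `S × S` is a kernel if it is symmetric and
positive (semi)definite: `∑ i j, c i * c j * k (x i, x j) ≥ 0` for finite families. -/
def IsKernel (k : S × S →ᵇ ℝ) : Prop :=
  (Matrix.of fun x y : S => k (x, y)).PosSemidef

/-- `‖k‖_diag = sup_x k (x, x)`. -/
noncomputable def diagNorm (k : S × S →ᵇ ℝ) : ℝ := ⨆ x : S, k (x, x)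

/-- The normalised class `{k / ‖k‖_diag : k ∈ 𝒦} ∪ {0}`. (A kernel with `‖k‖_diag = 0` is the zero
function, and contributes the element `0`.) -/
noncomputable def normalisedClass (𝒦 : Set (S × S →ᵇ ℝ)) : Set (S × S →ᵇ ℝ) :=
  (fun k => (diagNorm k)⁻¹ • k) '' 𝒦 ∪ {0}

/-- `J = (162 ∫_0^{D/2} log (2 N(a, L, ‖·‖_∞)) da + 1)^{1/2} ∈ [1, ∞]`, where `D` is the diameter
of `L` in the supremum norm and `N` is the covering number. -/
noncomputable def entropyConst (L : Set (S × S →ᵇ ℝ)) : ℝ≥0∞ :=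
  (162 * (∫⁻ a in Set.Ioc (0 : ℝ) (Metric.diam L / 2),
      (ENNReal.log (2 * (Metric.coveringNumber a.toNNReal L : ℝ≥0∞))).toENNReal) + 1)
    ^ (1 / 2 : ℝ)

/-- `W(f) = n⁻² ∑_{i,j} ε_i ε_j f(X_i, X_j)`. -/
noncomputable def quadForm {Ω : Type*} {n : ℕ} (X : Fin n → Ω → S) (ε : Fin n → Ω → ℝ)
    (f : S × S →ᵇ ℝ) (ω : Ω) : ℝ :=
  (1 / (n : ℝ) ^ 2) * ∑ i, ∑ j, ε i ω * ε j ω * f (X i ω, X j ω)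

end Kernels

end KernelChaining

/-!
The supremum is bounded by chaining over the class `L` with the uniform metric. The increment
`W f - W g` is a quadratic form `n⁻² ∑ i j, ε_i ε_j a (X_i, X_j)` with `a = f - g`, whose entries
are bounded by `δ = ‖f - g‖`. Its `ψ₁` norm is at most `16 σ² δ / n`
(`lintegral_exp_quadForm_sub_le`):

* the diagonal `∑ a (X_i, X_i) ε_i²` is dominated by `δ ∑ ε_i²`, a sum of squares of subgaussian
  variables (`lintegral_exp_diag_le`);
* the rest is `2 ∑_j ε_j L_j` with `L_j = ∑_{i < j} a (X_i, X_j) ε_i`. As `L_j` depends only on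
  `X_j` and the preceding pairs, `exp (∑_j (t ε_j L_j - σ² t² L_j² / 2))` has expectation at most
  `1` (`lintegral_exp_chaos_sub_le`). Each `L_j` is itself `σ² n δ²`-subgaussian, so that the
  compensator `∑_j L_j²` has exponential moments (`lintegral_exp_sq_chaosCoeff_le`). Together these
  give `lintegral_exp_chaos_le`, without decoupling and without spectral theory.

All this takes place on the law of the sample, a product of measures on `S × ℝ`, where conditional
subgaussianity becomes an inequality for integrals (`FiberSubgaussian`) and the coordinates are
integrated one at a time, the last one first (`lintegral_pi_snoc`).

Chaining through minimal nets of radii `D / 2 ^ k`, starting from the zero kernel, costs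
`b log (2 N) / log 2` for a maximum of `N` variables of `ψ₁` norm `b` (`lintegral_exp_iSup_le`);
summing over the levels gives `(4 / log 2) · 16 σ² / n` times the entropy integral
(`lintegral_exp_iSup_process_le`), and `64 / log 2 ≤ 4 · 162`.

The kernel property of the elements of `L` enters in two places. By the Cauchy–Schwarz inequality
they are bounded by `1`, and they are measurable for the product `σ`-algebra of `S × S` when `S` is
separable (`IsKernel.measurable`).
-/

namespace KernelChaining

/-! ### Kernels and the normalised class -/

section KernelLemmas

variable {S : Type*} [TopologicalSpace S]

theorem IsKernel.symm {k : S × S →ᵇ ℝ} (hk : IsKernel k) (x y : S) : k (x, y) = k (y, x) := by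
  have := hk.1.apply x y
  simpa using this.symm

theorem IsKernel.quadratic_nonneg {k : S × S →ᵇ ℝ} (hk : IsKernel k) (x y z : S) (a b c : ℝ) :
    0 ≤ a ^ 2 * k (x, x) + b ^ 2 * k (y, y) + c ^ 2 * k (z, z)
      + 2 * a * b * k (x, y) + 2 * a * c * k (x, z) + 2 * b * c * k (y, z) := by
  have h := (hk.submatrix ![x, y, z]).dotProduct_mulVec_nonneg ![a, b, c]
  simp [Matrix.mulVec, dotProduct, Fin.sum_univ_three] at h
  rw [hk.symm y x, hk.symm z x, hk.symm z y] at h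
  linarith

theorem IsKernel.diag_nonneg {k : S × S →ᵇ ℝ} (hk : IsKernel k) (x : S) : 0 ≤ k (x, x) := by
  have := hk.quadratic_nonneg x x x 1 0 0
  simpa using this

theorem IsKernel.abs_le {k : S × S →ᵇ ℝ} (hk : IsKernel k) {c : ℝ} (hc : ∀ x, k (x, x) ≤ c)
    (x y : S) : |k (x, y)| ≤ c := by
  have h1 := hk.quadratic_nonneg x y y 1 1 0
  have h2 := hk.quadratic_nonneg x y y 1 (-1) 0
  have h3 := hc x
  have h4 := hc y
  rw [_root_.abs_le]
  constructor <;> linarith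

/-- Cauchy–Schwarz in the reproducing kernel Hilbert space, applied to the feature vector of `x`
and the difference of those of `y` and `z`. -/
theorem IsKernel.sq_sub_le {k : S × S →ᵇ ℝ} (hk : IsKernel k) (x y z : S) :
    (k (x, y) - k (x, z)) ^ 2 ≤ k (x, x) * (k (y, y) - 2 * k (y, z) + k (z, z)) := by
  have h : ∀ t : ℝ, 0 ≤ k (x, x) * (t * t) + (2 * (k (x, y) - k (x, z))) * t
      + (k (y, y) - 2 * k (y, z) + k (z, z)) := fun t => by
    have := hk.quadratic_nonneg x y z t 1 (-1)
    linarith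
  have := discrim_le_zero h
  simp only [discrim] at this
  linarith

theorem IsKernel.smul {k : S × S →ᵇ ℝ} (hk : IsKernel k) {c : ℝ} (hc : 0 ≤ c) :
    IsKernel (c • k) := by
  have := Matrix.PosSemidef.smul hk hc
  exact this

theorem isKernel_zero : IsKernel (0 : S × S →ᵇ ℝ) := Matrix.PosSemidef.zero

theorem le_diagNorm (k : S × S →ᵇ ℝ) (x : S) : k (x, x) ≤ diagNorm k := by
  refine le_ciSup (f := fun x : S => k (x, x)) ⟨‖k‖, ?_⟩ x
  rintro _ ⟨y, rfl⟩
  exact (le_abs_self _).trans (k.norm_coe_le_norm (y, y))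

/-- The section `y ↦ k (·, y)` of a kernel, as a map into the bounded continuous functions. -/
noncomputable def kernelSection (k : S × S →ᵇ ℝ) (y : S) : S →ᵇ ℝ :=
  k.compContinuous ⟨fun x => (x, y), by fun_prop⟩

theorem IsKernel.continuous_kernelSection {k : S × S →ᵇ ℝ} (hk : IsKernel k) :
    Continuous (kernelSection k) := by
  rw [continuous_iff_continuousAt]
  intro z
  rw [ContinuousAt, tendsto_iff_dist_tendsto_zero]
  have hlim : Filter.Tendsto
      (fun y => Real.sqrt (‖k‖ * (k (y, y) - 2 * k (y, z) + k (z, z)))) (nhds z) (nhds 0) := by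
    have hc : Continuous
        (fun y => Real.sqrt (‖k‖ * (k (y, y) - 2 * k (y, z) + k (z, z)))) := by fun_prop
    have := hc.tendsto z
    have h0 : ‖k‖ * (k (z, z) - 2 * k (z, z) + k (z, z)) = 0 := by ring
    simpa [h0] using this
  refine squeeze_zero (fun _ => dist_nonneg) (fun y => ?_) hlim
  rw [BoundedContinuousFunction.dist_le (Real.sqrt_nonneg _)]
  intro x
  refine Real.abs_le_sqrt ((hk.sq_sub_le x y z).trans ?_)
  refine mul_le_mul_of_nonneg_right ((le_abs_self _).trans (k.norm_coe_le_norm (x, x))) ?_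
  have := hk.quadratic_nonneg y z z 1 (-1) 0
  linarith

/-- A kernel is measurable for the product `σ`-algebra, although that may be smaller than the
Borel `σ`-algebra of `S × S`: as `y ↦ k (·, y)` is continuous with separable range, `k` is a
Carathéodory function. -/
theorem IsKernel.measurable [TopologicalSpace.SeparableSpace S] [MeasurableSpace S]
    [OpensMeasurableSpace S] {k : S × S →ᵇ ℝ} (hk : IsKernel k) :
    Measurable (fun p : S × S => k p) := by
  let R := Set.range (kernelSection k)
  let F : S → R := Set.rangeFactorization (kernelSection k)
  have hF : Continuous F := hk.continuous_kernelSection.subtype_mk _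
  have hsep : TopologicalSpace.SeparableSpace R :=
    (TopologicalSpace.isSeparable_range hk.continuous_kernelSection).separableSpace
  have : SecondCountableTopology R := UniformSpace.secondCountable_of_separable R
  let : MeasurableSpace R := borel R
  have : BorelSpace R := ⟨rfl⟩
  have hu : Measurable (Function.uncurry fun (g : R) (x : S) => (g : S →ᵇ ℝ) x) := by
    refine measurable_uncurry_of_continuous_of_measurable (fun x => ?_) fun g => ?_
    · exact (continuous_eval_const x).comp continuous_subtype_val
    · exact (g : S →ᵇ ℝ).continuous.measurable
  have := hu.comp ((hF.measurable.comp measurable_snd).prodMk measurable_fst)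
  exact this

variable {𝒦 : Set (S × S →ᵇ ℝ)}

theorem zero_mem_normalisedClass : (0 : S × S →ᵇ ℝ) ∈ normalisedClass 𝒦 := Or.inr rfl

theorem diagNorm_nonneg {k : S × S →ᵇ ℝ} (hk : IsKernel k) : 0 ≤ diagNorm k :=
  Real.iSup_nonneg hk.diag_nonneg

theorem isKernel_of_mem_normalisedClass (h𝒦 : ∀ k ∈ 𝒦, IsKernel k) {f : S × S →ᵇ ℝ}
    (hf : f ∈ normalisedClass 𝒦) : IsKernel f := by
  rcases hf with ⟨k, hk, rfl⟩ | rfl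
  · exact (h𝒦 k hk).smul (inv_nonneg.2 (diagNorm_nonneg (h𝒦 k hk)))
  · exact isKernel_zero

theorem abs_le_one_of_mem_normalisedClass (h𝒦 : ∀ k ∈ 𝒦, IsKernel k) {f : S × S →ᵇ ℝ}
    (hf : f ∈ normalisedClass 𝒦) (p : S × S) : |f p| ≤ 1 := by
  refine (isKernel_of_mem_normalisedClass h𝒦 hf).abs_le (fun x => ?_) p.1 p.2
  rcases hf with ⟨k, hk, rfl⟩ | rfl
  · have h0 := diagNorm_nonneg (h𝒦 k hk)
    calc (diagNorm k)⁻¹ * k (x, x) ≤ (diagNorm k)⁻¹ * diagNorm k :=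
          mul_le_mul_of_nonneg_left (le_diagNorm k x) (inv_nonneg.2 h0)
      _ ≤ 1 := inv_mul_le_one
  · simp

theorem isSeparable_normalisedClass (h𝒦 : TopologicalSpace.IsSeparable 𝒦) :
    TopologicalSpace.IsSeparable (normalisedClass 𝒦) := by
  refine TopologicalSpace.IsSeparable.union ?_ (Set.countable_singleton 0).isSeparable
  have h := ((TopologicalSpace.IsSeparable.of_separableSpace (Set.univ : Set ℝ)).prod h𝒦).image
    (f := fun p : ℝ × (S × S →ᵇ ℝ) => p.1 • p.2) (by fun_prop)
  refine h.mono ?_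
  rintro _ ⟨k, hk, rfl⟩
  exact ⟨((diagNorm k)⁻¹, k), ⟨trivial, hk⟩, rfl⟩

theorem isBounded_normalisedClass (h𝒦 : ∀ k ∈ 𝒦, IsKernel k) :
    Bornology.IsBounded (normalisedClass 𝒦) := by
  refine isBounded_iff_forall_norm_le.2 ⟨1, fun f hf => ?_⟩
  exact (BoundedContinuousFunction.norm_le zero_le_one).2
    (abs_le_one_of_mem_normalisedClass h𝒦 hf)

section QuadForm

variable {Ω : Type*} {n : ℕ} (X : Fin n → Ω → S) (ε : Fin n → Ω → ℝ)

theorem quadForm_zero (ω : Ω) : quadForm X ε 0 ω = 0 := by simp [quadForm]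

theorem quadForm_sub (f g : S × S →ᵇ ℝ) (ω : Ω) :
    quadForm X ε f ω - quadForm X ε g ω = (1 / (n : ℝ) ^ 2) *
      ∑ i, ∑ j, ε i ω * ε j ω * (f (X i ω, X j ω) - g (X i ω, X j ω)) := by
  simp only [quadForm, ← mul_sub, ← Finset.sum_sub_distrib]

/-- For fixed data the quadratic form is Lipschitz in the kernel. -/
theorem abs_quadForm_sub_le (f g : S × S →ᵇ ℝ) (ω : Ω) :
    |quadForm X ε f ω - quadForm X ε g ω|
      ≤ ((1 / (n : ℝ) ^ 2) * ∑ i, ∑ j, |ε i ω * ε j ω|) * dist f g := by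
  rw [quadForm_sub, abs_mul, abs_of_nonneg (by positivity), mul_assoc]
  refine mul_le_mul_of_nonneg_left ?_ (by positivity)
  rw [Finset.sum_mul]
  refine (Finset.abs_sum_le_sum_abs _ _).trans (Finset.sum_le_sum fun i _ => ?_)
  rw [Finset.sum_mul]
  refine (Finset.abs_sum_le_sum_abs _ _).trans (Finset.sum_le_sum fun j _ => ?_)
  rw [abs_mul]
  exact mul_le_mul_of_nonneg_left (f.dist_coe_le_dist (g := g) _) (abs_nonneg _)

theorem continuous_quadForm (ω : Ω) : Continuous fun f => quadForm X ε f ω := by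
  refine (LipschitzWith.of_dist_le_mul (K := Real.toNNReal
    ((1 / (n : ℝ) ^ 2) * ∑ i, ∑ j, |ε i ω * ε j ω|)) fun f g => ?_).continuous
  rw [Real.coe_toNNReal _ (by positivity)]
  exact abs_quadForm_sub_le X ε f g ω

theorem bddAbove_quadForm (h𝒦 : ∀ k ∈ 𝒦, IsKernel k) (ω : Ω) :
    BddAbove (Set.range fun f : normalisedClass 𝒦 => quadForm X ε f ω) := by
  refine ⟨(1 / (n : ℝ) ^ 2) * ∑ i, ∑ j, |ε i ω * ε j ω|, ?_⟩
  rintro _ ⟨f, rfl⟩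
  have h := abs_quadForm_sub_le X ε f 0 ω
  rw [quadForm_zero, sub_zero, dist_zero_right] at h
  refine (le_abs_self _).trans (h.trans (mul_le_of_le_one_right (by positivity) ?_))
  exact (BoundedContinuousFunction.norm_le zero_le_one).2
    (abs_le_one_of_mem_normalisedClass h𝒦 f.2)

variable [MeasurableSpace Ω] [MeasurableSpace S]

theorem measurable_quadForm (hX : ∀ i, Measurable (X i)) (hε : ∀ i, Measurable (ε i))
    {f : S × S →ᵇ ℝ} (hf : Measurable fun p : S × S => f p) : Measurable (quadForm X ε f) := by
  unfold quadForm
  refine Measurable.const_mul ?_ _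
  refine Finset.measurable_sum _ fun i _ => Finset.measurable_sum _ fun j _ => ?_
  exact ((hε i).mul (hε j)).mul (hf.comp ((hX i).prodMk (hX j)))

/-- By continuity in the kernel, the supremum is one over a countable dense subset. -/
theorem measurable_iSup_quadForm [TopologicalSpace.SeparableSpace S] [OpensMeasurableSpace S]
    (h𝒦 : ∀ k ∈ 𝒦, IsKernel k) (h𝒦_sep : TopologicalSpace.IsSeparable 𝒦)
    (hX : ∀ i, Measurable (X i)) (hε : ∀ i, Measurable (ε i)) :
    Measurable fun ω => ⨆ f : normalisedClass 𝒦, quadForm X ε f ω := by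
  have : TopologicalSpace.SeparableSpace (normalisedClass 𝒦) :=
    (isSeparable_normalisedClass h𝒦_sep).separableSpace
  obtain ⟨s, hs, hsd⟩ := TopologicalSpace.exists_countable_dense (normalisedClass 𝒦)
  have h : (fun ω => ⨆ f : normalisedClass 𝒦, quadForm X ε f ω)
      = fun ω => ⨆ f : s, quadForm X ε (f : normalisedClass 𝒦) ω := by
    funext ω
    exact (hsd.ciSup (f := fun f : normalisedClass 𝒦 => quadForm X ε f ω)
      ((continuous_quadForm X ε ω).comp continuous_subtype_val)
      (bddAbove_quadForm X ε h𝒦 ω)).symm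
  rw [h]
  have := hs.to_subtype
  exact Measurable.iSup fun f => measurable_quadForm X ε hX hε
    (isKernel_of_mem_normalisedClass h𝒦 f.1.2).measurable

end QuadForm

end KernelLemmas

/-! ### Conditionally subgaussian variables -/

section Subgaussian

variable {S : Type*} [MeasurableSpace S]

/-- Under the law `ν` on `S × ℝ`, the second coordinate is `c`-subgaussian given the first. This
form replaces the constant `t` of `CondSubgaussian` by a function `L` of the conditioning variable,
and divides by the bound, so that no conditional expectation is involved. -/
def FiberSubgaussian (ν : Measure (S × ℝ)) (c : ℝ) : Prop :=
  ∀ L : S → ℝ, Measurable L →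
    ∫⁻ p, ENNReal.ofReal (Real.exp (p.2 * L p.1 - c * L p.1 ^ 2 / 2)) ∂ν ≤ 1

theorem CondSubgaussian.fiberSubgaussian {Ω : Type*} [MeasurableSpace Ω] {μ : Measure Ω}
    [IsProbabilityMeasure μ] {X : Ω → S} {ε : Ω → ℝ} {c : ℝ} (h : CondSubgaussian ε X c μ)
    (hX : Measurable X) (hε : Measurable ε) :
    FiberSubgaussian (μ.map fun ω => (X ω, ε ω)) c := by
  intro L hL
  rw [lintegral_map (by fun_prop) (hX.prodMk hε)]
  -- On an event determined by `X`, the bound for a constant is the definition of `E (· | X)`.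
  have hset : ∀ (v : ℝ) (B : Set S), MeasurableSet B →
      ∫⁻ ω in X ⁻¹' B, ENNReal.ofReal (Real.exp (ε ω * v - c * v ^ 2 / 2)) ∂μ
        ≤ μ (X ⁻¹' B) := by
    intro v B hB
    have hm : MeasurableSpace.comap X inferInstance ≤ (inferInstance : MeasurableSpace Ω) :=
      hX.comap_le
    have hB' : MeasurableSet[MeasurableSpace.comap X inferInstance] (X ⁻¹' B) := ⟨B, hB, rfl⟩
    have h1 : ∫ ω in X ⁻¹' B, Real.exp (v * ε ω) ∂μ
        ≤ Real.exp (c * v ^ 2 / 2) * μ.real (X ⁻¹' B) := by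
      rw [← setIntegral_condExp hm (h.integrable_exp v) hB']
      calc _ ≤ ∫ ω in X ⁻¹' B, Real.exp (c * v ^ 2 / 2) ∂μ :=
            setIntegral_mono_ae integrable_condExp.integrableOn
              (integrable_const _).integrableOn (h.condExp_le v)
        _ = _ := by rw [setIntegral_const, smul_eq_mul, mul_comm]
    have h2 : ∫⁻ ω in X ⁻¹' B, ENNReal.ofReal (Real.exp (v * ε ω)) ∂μ
        ≤ ENNReal.ofReal (Real.exp (c * v ^ 2 / 2)) * μ (X ⁻¹' B) := by
      rw [← ofReal_integral_eq_lintegral_ofReal (h.integrable_exp v).integrableOn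
        (Filter.Eventually.of_forall fun _ => (Real.exp_pos _).le)]
      refine (ENNReal.ofReal_le_ofReal h1).trans_eq ?_
      rw [ENNReal.ofReal_mul (Real.exp_pos _).le, ofReal_measureReal]
    have h3 : ∀ ω, ENNReal.ofReal (Real.exp (ε ω * v - c * v ^ 2 / 2))
        = ENNReal.ofReal (Real.exp (-(c * v ^ 2 / 2))) * ENNReal.ofReal (Real.exp (v * ε ω)) := by
      intro ω
      rw [← ENNReal.ofReal_mul (Real.exp_pos _).le, ← Real.exp_add]
      ring_nf
    simp_rw [h3]
    rw [lintegral_const_mul _ (by fun_prop)]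
    refine (mul_le_mul_right h2 _).trans_eq ?_
    rw [← mul_assoc, ← ENNReal.ofReal_mul (Real.exp_pos _).le, ← Real.exp_add]
    simp
  have hsimple : ∀ φ : SimpleFunc S ℝ,
      ∫⁻ ω, ENNReal.ofReal (Real.exp (ε ω * φ (X ω) - c * φ (X ω) ^ 2 / 2)) ∂μ ≤ 1 := by
    intro φ
    have hcover : (Set.univ : Set Ω) = ⋃ v ∈ φ.range, X ⁻¹' (φ ⁻¹' {v}) := by
      ext ω; simp
    have hdisj : Set.PairwiseDisjoint (φ.range : Set ℝ) fun v => X ⁻¹' (φ ⁻¹' {v}) := by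
      intro u _ v _ huv
      refine Set.disjoint_left.2 fun ω h1 h2 => huv ?_
      exact h1.symm.trans h2
    have hmeas : ∀ v ∈ φ.range, MeasurableSet (X ⁻¹' (φ ⁻¹' {v})) := fun v _ =>
      hX (φ.measurableSet_preimage _)
    rw [← setLIntegral_univ, hcover, lintegral_biUnion_finset hdisj hmeas]
    calc _ ≤ ∑ v ∈ φ.range, μ (X ⁻¹' (φ ⁻¹' {v})) := Finset.sum_le_sum fun v hv => by
          refine le_trans (le_of_eq ?_) (hset v _ (φ.measurableSet_preimage {v}))
          refine setLIntegral_congr_fun (hmeas v hv) fun ω hω => ?_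
          have : φ (X ω) = v := hω
          simp only [this]
      _ = μ Set.univ := by rw [hcover, measure_biUnion_finset hdisj hmeas]
      _ = 1 := measure_univ
  have hLs := hL.stronglyMeasurable
  have hlim : ∀ ω, Filter.Tendsto (fun m => ENNReal.ofReal (Real.exp
        (ε ω * hLs.approx m (X ω) - c * hLs.approx m (X ω) ^ 2 / 2))) Filter.atTop
      (nhds (ENNReal.ofReal (Real.exp (ε ω * L (X ω) - c * L (X ω) ^ 2 / 2)))) := by
    intro ω
    have hc : Continuous fun l : ℝ =>
      ENNReal.ofReal (Real.exp (ε ω * l - c * l ^ 2 / 2)) :=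
      ENNReal.continuous_ofReal.comp (by fun_prop)
    exact (hc.tendsto _).comp (hLs.tendsto_approx (X ω))
  calc _ = ∫⁻ ω, Filter.liminf (fun m => ENNReal.ofReal (Real.exp
        (ε ω * hLs.approx m (X ω) - c * hLs.approx m (X ω) ^ 2 / 2))) Filter.atTop ∂μ :=
        lintegral_congr fun ω => (hlim ω).liminf_eq.symm
    _ ≤ Filter.liminf (fun m => ∫⁻ ω, ENNReal.ofReal (Real.exp
        (ε ω * hLs.approx m (X ω) - c * hLs.approx m (X ω) ^ 2 / 2)) ∂μ) Filter.atTop :=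
        lintegral_liminf_le fun m => by
          have := (hLs.approx m).measurable
          fun_prop
    _ ≤ Filter.liminf (fun _ => (1 : ℝ≥0∞)) Filter.atTop :=
        Filter.liminf_le_liminf (Filter.Eventually.of_forall fun m => hsimple _)
    _ = 1 := by simp

theorem FiberSubgaussian.lintegral_exp_le {ν : Measure (S × ℝ)} {c : ℝ}
    (h : FiberSubgaussian ν c) {L : S → ℝ} (hL : Measurable L) {δ : ℝ} (hc : 0 ≤ c)
    (hδ : ∀ x, |L x| ≤ δ) :
    ∫⁻ p, ENNReal.ofReal (Real.exp (L p.1 * p.2)) ∂ν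
      ≤ ENNReal.ofReal (Real.exp (c * δ ^ 2 / 2)) := by
  have hb : ∀ p : S × ℝ, ENNReal.ofReal (Real.exp (L p.1 * p.2))
      ≤ ENNReal.ofReal (Real.exp (c * δ ^ 2 / 2)) *
        ENNReal.ofReal (Real.exp (p.2 * L p.1 - c * L p.1 ^ 2 / 2)) := by
    intro p
    rw [← ENNReal.ofReal_mul (Real.exp_pos _).le, ← Real.exp_add]
    refine ENNReal.ofReal_le_ofReal (Real.exp_le_exp.2 ?_)
    have := mul_le_mul_of_nonneg_left (sq_le_sq.2 ((hδ p.1).trans (le_abs_self δ))) hc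
    linarith
  refine (lintegral_mono hb).trans ?_
  rw [lintegral_const_mul _ (by fun_prop)]
  exact mul_le_of_le_one_right' (h L hL)

/-- The square of a `v`-subgaussian variable is exponentially integrable. Since
`exp (s z²) = E exp (√(2s) g z)` for a standard Gaussian `g`, Fubini's theorem reduces the claim to
the Gaussian integral `E exp (s v g²) = (1 - 2 s v)^{-1/2}`, which is at most `4 / 3`
if `2 s v ≤ 7 / 16`. -/
theorem lintegral_exp_sq_le {α : Type*} [MeasurableSpace α] {P : Measure α} [SFinite P]
    {Z : α → ℝ} (hZ : Measurable Z) {v s : ℝ} (hs : 0 ≤ s)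
    (h : ∀ r : ℝ, ∫⁻ x, ENNReal.ofReal (Real.exp (r * Z x)) ∂P
      ≤ ENNReal.ofReal (Real.exp (v * r ^ 2 / 2)))
    (hsv : 2 * s * v ≤ 7 / 16) :
    ∫⁻ x, ENNReal.ofReal (Real.exp (s * Z x ^ 2)) ∂P ≤ ENNReal.ofReal (4 / 3) := by
  have hg : ∀ z : ℝ, ENNReal.ofReal (Real.exp (s * z ^ 2))
      = ∫⁻ g, ENNReal.ofReal (Real.exp ((Real.sqrt (2 * s) * g) * z)) ∂(gaussianReal 0 1) := by
    intro z
    have h1 := congrFun (mgf_id_gaussianReal (μ := 0) (v := 1)) (Real.sqrt (2 * s) * z)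
    have h2 : ∀ g : ℝ, Real.sqrt (2 * s) * g * z = Real.sqrt (2 * s) * z * g := fun g => by ring
    simp_rw [h2]
    rw [← ofReal_integral_eq_lintegral_ofReal (integrable_exp_mul_gaussianReal _)
      (Filter.Eventually.of_forall fun _ => (Real.exp_pos _).le)]
    congr 1
    simp only [mgf, id] at h1
    rw [h1, mul_pow, Real.sq_sqrt (by positivity)]
    congr 1
    push_cast
    ring
  simp_rw [hg]
  rw [lintegral_lintegral_swap (by fun_prop)]
  refine (lintegral_mono fun g => h (Real.sqrt (2 * s) * g)).trans ?_
  have h3 : ∀ g : ℝ, Real.exp (v * (Real.sqrt (2 * s) * g) ^ 2 / 2)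
      = Real.exp (s * v * g ^ 2) := by
    intro g
    rw [mul_pow, Real.sq_sqrt (by positivity)]
    ring_nf
  simp_rw [h3]
  rw [gaussianReal_of_var_ne_zero _ one_ne_zero,
    lintegral_withDensity_eq_lintegral_mul _ (measurable_gaussianPDF _ _) (by fun_prop)]
  have h4 : ∀ g : ℝ, (gaussianPDF 0 1 * fun g => ENNReal.ofReal (Real.exp (s * v * g ^ 2))) g
      = ENNReal.ofReal ((Real.sqrt (2 * Real.pi))⁻¹ * Real.exp (-(1 / 2 - s * v) * g ^ 2)) := by
    intro g
    simp only [Pi.mul_apply, gaussianPDF, gaussianPDFReal]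
    rw [← ENNReal.ofReal_mul (by positivity), mul_assoc, ← Real.exp_add]
    simp only [NNReal.coe_one, mul_one, sub_zero]
    ring_nf
  simp_rw [h4]
  have hb : 0 < 1 / 2 - s * v := by linarith
  rw [← ofReal_integral_eq_lintegral_ofReal ((integrable_exp_neg_mul_sq hb).const_mul _)
    (Filter.Eventually.of_forall fun _ => by positivity), integral_const_mul, integral_gaussian]
  refine ENNReal.ofReal_le_ofReal ?_
  rw [← Real.sqrt_inv, ← Real.sqrt_mul (by positivity), Real.sqrt_le_left (by norm_num)]
  have hpi := Real.pi_pos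
  rw [show (2 * Real.pi)⁻¹ * (Real.pi / (1 / 2 - s * v)) = (1 - 2 * s * v)⁻¹ by
    field_simp]
  rw [inv_le_comm₀ (by linarith) (by norm_num)]
  norm_num
  linarith

/-- Jensen's inequality for the exponential of a sum of `n` terms, integrated. -/
theorem lintegral_exp_sum_le {α : Type*} [MeasurableSpace α] {P : Measure α} {n : ℕ} (hn : 0 < n)
    {u : Fin n → α → ℝ} (hu : ∀ j, Measurable (u j)) {B : ℝ≥0∞}
    (h : ∀ j, ∫⁻ x, ENNReal.ofReal (Real.exp (n * u j x)) ∂P ≤ B) :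
    ∫⁻ x, ENNReal.ofReal (Real.exp (∑ j, u j x)) ∂P ≤ B := by
  have hn' : (n : ℝ) ≠ 0 := by positivity
  have hpt : ∀ x, ENNReal.ofReal (Real.exp (∑ j, u j x))
      ≤ ∑ j, ENNReal.ofReal (n : ℝ)⁻¹ * ENNReal.ofReal (Real.exp (n * u j x)) := by
    intro x
    have := convexOn_exp.map_sum_le (t := Finset.univ) (w := fun _ : Fin n => (n : ℝ)⁻¹)
      (p := fun j => n * u j x) (fun _ _ => by positivity) (by simp [hn']) (fun _ _ => trivial)
    simp only [smul_eq_mul, inv_mul_cancel_left₀ hn'] at this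
    refine (ENNReal.ofReal_le_ofReal this).trans_eq ?_
    rw [ENNReal.ofReal_sum_of_nonneg fun _ _ => by positivity]
    simp_rw [ENNReal.ofReal_mul (inv_nonneg.2 (Nat.cast_nonneg n))]
  refine (lintegral_mono hpt).trans ?_
  rw [lintegral_finsetSum _ fun j _ => by have := hu j; fun_prop]
  calc _ ≤ ∑ _j : Fin n, ENNReal.ofReal (n : ℝ)⁻¹ * B := Finset.sum_le_sum fun j _ => by
        rw [lintegral_const_mul _ (by have := hu j; fun_prop)]
        exact mul_le_mul_right (h j) _
    _ = B := by
        rw [Finset.sum_const, Finset.card_univ, Fintype.card_fin, nsmul_eq_mul, ← mul_assoc,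
          ← ENNReal.ofReal_natCast, ← ENNReal.ofReal_mul (Nat.cast_nonneg n),
          mul_inv_cancel₀ hn', ENNReal.ofReal_one, one_mul]

end Subgaussian

/-! ### Exponential moments of quadratic forms -/

section Chaos

/-- Tonelli's theorem for a finite product measure, singling out the last coordinate. -/
theorem lintegral_pi_snoc {E : Type*} [MeasurableSpace E] {n : ℕ} (ν : Fin (n + 1) → Measure E)
    [∀ i, SigmaFinite (ν i)] {F : (Fin (n + 1) → E) → ℝ≥0∞} (hF : Measurable F) :
    ∫⁻ y, F y ∂(Measure.pi ν)
      = ∫⁻ y, ∫⁻ z, F (Fin.snoc (α := fun _ => E) y z) ∂(ν (Fin.last n))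
          ∂(Measure.pi fun i : Fin n => ν i.castSucc) := by
  have h := (measurePreserving_piFinSuccAbove ν (Fin.last n)).symm
  have hm : Measurable fun p : E × (Fin n → E) =>
      F ((MeasurableEquiv.piFinSuccAbove (fun _ => E) (Fin.last n)).symm p) :=
    hF.comp (MeasurableEquiv.measurable _)
  rw [← h.lintegral_comp hF, lintegral_prod_symm' _ hm]
  simp only [Fin.succAbove_last, MeasurableEquiv.piFinSuccAbove_symm_apply, Fin.insertNthEquiv,
    Equiv.coe_fn_mk, Fin.insertNth_last']

variable {S : Type*} {n : ℕ}

/-- The coefficient `∑_{i < j} a (x_i, x_j) e_i` of `e_j` in the strictly triangular part of the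
quadratic form `∑ i j, e_i e_j a (x_i, x_j)`, for the sample `y i = (x_i, e_i)`. -/
noncomputable def chaosCoeff (a : S × S → ℝ) (y : Fin n → S × ℝ) (j : Fin n) : ℝ :=
  ∑ i, if i < j then a ((y i).1, (y j).1) * (y i).2 else 0

theorem chaosCoeff_snoc_castSucc (a : S × S → ℝ) (y : Fin n → S × ℝ) (z : S × ℝ) (j : Fin n) :
    chaosCoeff a (Fin.snoc (α := fun _ => S × ℝ) y z) j.castSucc = chaosCoeff a y j := by
  simp [chaosCoeff, Fin.sum_univ_castSucc, Fin.castSucc_lt_castSucc_iff,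
    (Fin.castSucc_lt_last j).not_gt]

theorem chaosCoeff_snoc_last (a : S × S → ℝ) (y : Fin n → S × ℝ) (z : S × ℝ) :
    chaosCoeff a (Fin.snoc (α := fun _ => S × ℝ) y z) (Fin.last n)
      = ∑ i, a ((y i).1, z.1) * (y i).2 := by
  simp [chaosCoeff, Fin.sum_univ_castSucc, Fin.castSucc_lt_last]

/-- A symmetric quadratic form is its diagonal plus twice its strictly triangular part. -/
theorem sum_sum_eq_diag_add_chaos {a : S × S → ℝ} (ha : ∀ x x', a (x, x') = a (x', x))
    (y : Fin n → S × ℝ) :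
    ∑ i, ∑ j, (y i).2 * (y j).2 * a ((y i).1, (y j).1)
      = ∑ j, (y j).2 ^ 2 * a ((y j).1, (y j).1) + 2 * ∑ j, (y j).2 * chaosCoeff a y j := by
  have hlow : ∑ j, (y j).2 * chaosCoeff a y j
      = ∑ i, ∑ j, if i < j then (y i).2 * (y j).2 * a ((y i).1, (y j).1) else 0 := by
    rw [Finset.sum_comm]
    refine Finset.sum_congr rfl fun j _ => ?_
    rw [chaosCoeff, Finset.mul_sum]
    refine Finset.sum_congr rfl fun i _ => ?_
    split_ifs <;> ring
  have hupp : ∑ j, (y j).2 * chaosCoeff a y j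
      = ∑ i, ∑ j, if j < i then (y i).2 * (y j).2 * a ((y i).1, (y j).1) else 0 := by
    refine Finset.sum_congr rfl fun j _ => ?_
    rw [chaosCoeff, Finset.mul_sum]
    refine Finset.sum_congr rfl fun i _ => ?_
    rw [ha]
    split_ifs <;> ring
  have hdiag : ∑ j, (y j).2 ^ 2 * a ((y j).1, (y j).1)
      = ∑ i, ∑ j, if i = j then (y i).2 * (y j).2 * a ((y i).1, (y j).1) else 0 := by
    refine Finset.sum_congr rfl fun j _ => ?_
    simp [sq]
  rw [two_mul]
  nth_rewrite 1 [hlow]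
  rw [hupp, hdiag]
  simp only [← Finset.sum_add_distrib]
  refine Finset.sum_congr rfl fun i _ => Finset.sum_congr rfl fun j _ => ?_
  rcases lt_trichotomy i j with h | h | h
  · simp [h, h.ne, h.not_gt]
  · simp [h]
  · simp [h, h.ne', h.not_gt]

variable [MeasurableSpace S]

@[fun_prop]
theorem measurable_chaosCoeff {a : S × S → ℝ} (ha : Measurable a) (j : Fin n) :
    Measurable fun y : Fin n → S × ℝ => chaosCoeff a y j := by
  unfold chaosCoeff
  refine Finset.measurable_sum _ fun i _ => ?_
  split_ifs <;> fun_prop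

/-- Since the coefficient of `e_j` depends only on `x_j` and on the preceding pairs `(x_i, e_i)`,
the exponentials of the triangular sums, compensated by their subgaussian variances, form a
supermartingale. -/
theorem lintegral_exp_chaos_sub_le {a : S × S → ℝ} (ha : Measurable a) (c t : ℝ) {n : ℕ}
    (ν : Fin n → Measure (S × ℝ)) [∀ i, IsProbabilityMeasure (ν i)]
    (hν : ∀ i, FiberSubgaussian (ν i) c) :
    ∫⁻ y, ENNReal.ofReal (Real.exp
      (∑ j, ((y j).2 * (t * chaosCoeff a y j) - c * (t * chaosCoeff a y j) ^ 2 / 2)))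
        ∂(Measure.pi ν) ≤ 1 := by
  induction n with
  | zero => simp
  | succ n ih =>
    rw [lintegral_pi_snoc ν (by fun_prop)]
    refine (lintegral_mono fun y => ?_).trans (ih (fun i => ν i.castSucc) fun i => hν _)
    simp only [Fin.sum_univ_castSucc, Fin.snoc_castSucc, Fin.snoc_last, chaosCoeff_snoc_castSucc,
      chaosCoeff_snoc_last, Real.exp_add, ENNReal.ofReal_mul (Real.exp_pos _).le]
    have hL : Measurable fun x : S => t * ∑ i, a ((y i).1, x) * (y i).2 := by fun_prop
    rw [lintegral_const_mul _ (by fun_prop)]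
    exact mul_le_of_le_one_right' (hν (Fin.last n) _ hL)

/-- Linear forms in the noise, with coefficients bounded by `δ` that may depend on the design
points, are `c n δ²`-subgaussian. -/
theorem lintegral_exp_linear_le {b : S → ℝ} (hb : Measurable b) {c δ : ℝ} (hc : 0 ≤ c)
    (hδ : ∀ x, |b x| ≤ δ) (r : ℝ) {n : ℕ} (ν : Fin n → Measure (S × ℝ))
    [∀ i, IsProbabilityMeasure (ν i)] (hν : ∀ i, FiberSubgaussian (ν i) c) :
    ∫⁻ y, ENNReal.ofReal (Real.exp (r * ∑ i, b (y i).1 * (y i).2)) ∂(Measure.pi ν)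
      ≤ ENNReal.ofReal (Real.exp (c * n * δ ^ 2 * r ^ 2 / 2)) := by
  induction n with
  | zero => simp
  | succ n ih =>
    rw [lintegral_pi_snoc ν (by fun_prop)]
    have hone := (hν (Fin.last n)).lintegral_exp_le (hb.const_mul r) (δ := |r| * δ) hc fun x => by
      rw [abs_mul]; exact mul_le_mul_of_nonneg_left (hδ x) (abs_nonneg r)
    simp only [Fin.sum_univ_castSucc, Fin.snoc_castSucc, Fin.snoc_last, mul_add, Real.exp_add,
      ENNReal.ofReal_mul (Real.exp_pos _).le, ← mul_assoc r (b _)]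
    calc _ ≤ ∫⁻ y : Fin n → S × ℝ, ENNReal.ofReal (Real.exp (r * ∑ i, b (y i).1 * (y i).2)) *
          ENNReal.ofReal (Real.exp (c * (|r| * δ) ^ 2 / 2))
            ∂(Measure.pi fun i : Fin n => ν i.castSucc) := by
          refine lintegral_mono fun y => ?_
          rw [lintegral_const_mul _ (by fun_prop)]
          exact mul_le_mul_right hone _
      _ ≤ ENNReal.ofReal (Real.exp (c * n * δ ^ 2 * r ^ 2 / 2)) *
          ENNReal.ofReal (Real.exp (c * (|r| * δ) ^ 2 / 2)) := by
          rw [lintegral_mul_const _ (by fun_prop)]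
          exact mul_le_mul_left (ih (fun i => ν i.castSucc) fun i => hν _) _
      _ = _ := by
          rw [← ENNReal.ofReal_mul (Real.exp_pos _).le, ← Real.exp_add, mul_pow, sq_abs]
          push_cast
          ring_nf

/-- The squares of the coefficients have exponential moments. For the last index, the coefficient is
a linear form in the noise for each value of the last design point; the other coefficients do not
involve the last coordinate. The bound `N` on the sample size stays fixed in this induction. -/
theorem lintegral_exp_sq_chaosCoeff_le {a : S × S → ℝ} (ha : Measurable a) {c δ s : ℝ}
    (hc : 0 ≤ c) (hs : 0 ≤ s) (hδ : ∀ p, |a p| ≤ δ) {n N : ℕ} (hnN : n ≤ N)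
    (hsN : 2 * s * (c * N * δ ^ 2) ≤ 7 / 16)
    (ν : Fin n → Measure (S × ℝ)) [∀ i, IsProbabilityMeasure (ν i)]
    (hν : ∀ i, FiberSubgaussian (ν i) c) (j : Fin n) :
    ∫⁻ y, ENNReal.ofReal (Real.exp (s * chaosCoeff a y j ^ 2)) ∂(Measure.pi ν)
      ≤ ENNReal.ofReal (4 / 3) := by
  induction n with
  | zero => exact j.elim0
  | succ n ih =>
    rw [lintegral_pi_snoc ν (by fun_prop)]
    induction j using Fin.lastCases with
    | cast j =>
      simp only [chaosCoeff_snoc_castSucc, lintegral_const, measure_univ, mul_one]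
      exact ih (by omega) (fun i => ν i.castSucc) (fun i => hν _) j
    | last =>
      simp only [chaosCoeff_snoc_last]
      rw [lintegral_lintegral_swap (by fun_prop)]
      have hle : c * n * δ ^ 2 ≤ c * N * δ ^ 2 := by
        have : (n : ℝ) ≤ N := by exact_mod_cast (by omega : n ≤ N)
        gcongr
      have hz : ∀ z : S × ℝ, ∫⁻ y : Fin n → S × ℝ, ENNReal.ofReal (Real.exp
          (s * (∑ i, a ((y i).1, z.1) * (y i).2) ^ 2))
            ∂(Measure.pi fun i : Fin n => ν i.castSucc) ≤ ENNReal.ofReal (4 / 3) := fun z =>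
        lintegral_exp_sq_le (v := c * n * δ ^ 2) (by fun_prop) hs
          (fun r => lintegral_exp_linear_le (b := fun x => a (x, z.1)) (by fun_prop) hc
            (fun x => hδ _) r (fun i : Fin n => ν i.castSucc) fun i => hν _)
          ((mul_le_mul_of_nonneg_left hle (by positivity)).trans hsN)
      refine (lintegral_mono hz).trans ?_
      simp

/-- The triangular part of the chaos has exponential moments: by the inequality between the means,
`exp T` is at most the mean of a compensated exponential and of the exponential of its compensator,
and the latter is an average of squares of subgaussian variables. -/
theorem lintegral_exp_chaos_le {a : S × S → ℝ} (ha : Measurable a) {c δ t : ℝ}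
    (hc : 0 ≤ c) (hδ : ∀ p, |a p| ≤ δ) {n : ℕ} (hn : 0 < n)
    (ht : 4 * (t * (c * n * δ)) ^ 2 ≤ 7 / 16)
    (ν : Fin n → Measure (S × ℝ)) [∀ i, IsProbabilityMeasure (ν i)]
    (hν : ∀ i, FiberSubgaussian (ν i) c) :
    ∫⁻ y, ENNReal.ofReal (Real.exp (t * ∑ j, (y j).2 * chaosCoeff a y j)) ∂(Measure.pi ν)
      ≤ ENNReal.ofReal (7 / 6) := by
  have hpt : ∀ y : Fin n → S × ℝ,
      ENNReal.ofReal (Real.exp (t * ∑ j, (y j).2 * chaosCoeff a y j))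
      ≤ ENNReal.ofReal (1 / 2) * ENNReal.ofReal (Real.exp (∑ j, ((y j).2 *
          ((2 * t) * chaosCoeff a y j) - c * ((2 * t) * chaosCoeff a y j) ^ 2 / 2)))
        + ENNReal.ofReal (1 / 2) * ENNReal.ofReal (Real.exp (∑ j,
          2 * c * t ^ 2 * chaosCoeff a y j ^ 2)) := by
    intro y
    rw [← ENNReal.ofReal_mul (by norm_num), ← ENNReal.ofReal_mul (by norm_num),
      ← ENNReal.ofReal_add (by positivity) (by positivity)]
    refine ENNReal.ofReal_le_ofReal ?_
    have h := convexOn_exp.2 (Set.mem_univ (∑ j, ((y j).2 *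
          ((2 * t) * chaosCoeff a y j) - c * ((2 * t) * chaosCoeff a y j) ^ 2 / 2)))
      (Set.mem_univ (∑ j, 2 * c * t ^ 2 * chaosCoeff a y j ^ 2))
      (by norm_num : (0 : ℝ) ≤ 1 / 2) (by norm_num : (0 : ℝ) ≤ 1 / 2) (by norm_num)
    simp only [smul_eq_mul] at h
    refine le_trans (le_of_eq ?_) h
    rw [Finset.mul_sum, Finset.mul_sum, Finset.mul_sum, ← Finset.sum_add_distrib]
    congr 1
    refine Finset.sum_congr rfl fun j _ => ?_
    ring
  refine (lintegral_mono hpt).trans ?_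
  rw [lintegral_add_left (by fun_prop), lintegral_const_mul _ (by fun_prop),
    lintegral_const_mul _ (by fun_prop)]
  have h1 := lintegral_exp_chaos_sub_le ha c (2 * t) ν hν
  have h2 : ∫⁻ y : Fin n → S × ℝ, ENNReal.ofReal (Real.exp (∑ j,
      2 * c * t ^ 2 * chaosCoeff a y j ^ 2)) ∂(Measure.pi ν) ≤ ENNReal.ofReal (4 / 3) := by
    refine lintegral_exp_sum_le hn (fun j => by fun_prop) fun j => ?_
    simp_rw [← mul_assoc]
    refine lintegral_exp_sq_chaosCoeff_le ha hc (by positivity) hδ le_rfl ?_ ν hν j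
    linarith
  calc _ ≤ ENNReal.ofReal (1 / 2) * ENNReal.ofReal 1
        + ENNReal.ofReal (1 / 2) * ENNReal.ofReal (4 / 3) := by
        rw [ENNReal.ofReal_one]; gcongr
    _ = ENNReal.ofReal (7 / 6) := by
        rw [← ENNReal.ofReal_mul (by norm_num), ← ENNReal.ofReal_mul (by norm_num),
          ← ENNReal.ofReal_add (by norm_num) (by norm_num)]
        norm_num

theorem lintegral_exp_diag_le {c s : ℝ} (hc : 0 ≤ c) (hs : 0 ≤ s) {n : ℕ} (hn : 0 < n)
    (hsn : 2 * (n * s) * c ≤ 7 / 16)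
    (ν : Fin n → Measure (S × ℝ)) [∀ i, IsProbabilityMeasure (ν i)]
    (hν : ∀ i, FiberSubgaussian (ν i) c) :
    ∫⁻ y, ENNReal.ofReal (Real.exp (∑ j, s * (y j).2 ^ 2)) ∂(Measure.pi ν)
      ≤ ENNReal.ofReal (4 / 3) := by
  refine lintegral_exp_sum_le hn (fun j => by fun_prop) fun j => ?_
  have hF : Measurable fun z : S × ℝ => ENNReal.ofReal (Real.exp (n * (s * z.2 ^ 2))) := by
    fun_prop
  rw [(measurePreserving_eval ν j).lintegral_comp hF]
  simp_rw [← mul_assoc]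
  refine lintegral_exp_sq_le (v := c) measurable_snd (by positivity) (fun r => ?_) hsn
  exact (hν j).lintegral_exp_le (L := fun _ => r) measurable_const (δ := |r|) hc (fun _ => le_rfl)
    |>.trans_eq (by rw [sq_abs])

/-- The exponential moment bound for a quadratic form in the noise whose matrix has entries bounded
by `δ`: its `ψ₁` norm is at most `16 c n δ`. -/
theorem lintegral_exp_quadratic_le {a : S × S → ℝ} (ha : Measurable a)
    (hsymm : ∀ x x', a (x, x') = a (x', x)) {c δ : ℝ} (hc : 0 < c) (hδ0 : 0 < δ)
    (hδ : ∀ p, |a p| ≤ δ) {n : ℕ} (hn : 0 < n)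
    (ν : Fin n → Measure (S × ℝ)) [∀ i, IsProbabilityMeasure (ν i)]
    (hν : ∀ i, FiberSubgaussian (ν i) c) :
    ∫⁻ y, ENNReal.ofReal (Real.exp (|∑ i, ∑ j, (y i).2 * (y j).2 * a ((y i).1, (y j).1)|
      / (16 * c * n * δ))) ∂(Measure.pi ν) ≤ 2 := by
  have hn' : (0 : ℝ) < n := by exact_mod_cast hn
  set l : ℝ := (16 * c * n * δ)⁻¹ with hl
  have hl0 : 0 < l := by positivity
  have hlc : l * (c * n * δ) = 1 / 16 := by rw [hl]; field_simp
  have hpt : ∀ y : Fin n → S × ℝ,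
      ENNReal.ofReal (Real.exp (|∑ i, ∑ j, (y i).2 * (y j).2 * a ((y i).1, (y j).1)|
        / (16 * c * n * δ)))
      ≤ ENNReal.ofReal (1 / 2) * ENNReal.ofReal (Real.exp (∑ j, (2 * l * δ) * (y j).2 ^ 2))
        + ENNReal.ofReal (1 / 2) *
          (ENNReal.ofReal (Real.exp ((4 * l) * ∑ j, (y j).2 * chaosCoeff a y j))
          + ENNReal.ofReal (Real.exp ((-(4 * l)) * ∑ j, (y j).2 * chaosCoeff a y j))) := by
    intro y
    rw [← ENNReal.ofReal_mul (by norm_num), ← ENNReal.ofReal_add (by positivity) (by positivity),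
      ← ENNReal.ofReal_mul (by norm_num), ← ENNReal.ofReal_add (by positivity) (by positivity)]
    refine ENNReal.ofReal_le_ofReal ?_
    rw [sum_sum_eq_diag_add_chaos hsymm, div_eq_mul_inv, ← hl]
    set T := ∑ j, (y j).2 * chaosCoeff a y j
    have hD : |∑ j, (y j).2 ^ 2 * a ((y j).1, (y j).1)| ≤ δ * ∑ j, (y j).2 ^ 2 := by
      rw [Finset.mul_sum]
      refine (Finset.abs_sum_le_sum_abs _ _).trans (Finset.sum_le_sum fun j _ => ?_)
      rw [abs_mul, abs_of_nonneg (sq_nonneg (y j).2), mul_comm]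
      exact mul_le_mul_of_nonneg_right (hδ _) (sq_nonneg _)
    have htri : |∑ j, (y j).2 ^ 2 * a ((y j).1, (y j).1) + 2 * T| * l
        ≤ 1 / 2 * (∑ j, (2 * l * δ) * (y j).2 ^ 2) + 1 / 2 * (4 * l * |T|) := by
      have h1 := abs_add_le (∑ j, (y j).2 ^ 2 * a ((y j).1, (y j).1)) (2 * T)
      rw [abs_mul 2 T, abs_two] at h1
      have h2 := mul_le_mul_of_nonneg_right (h1.trans (add_le_add_left hD _)) hl0.le
      rw [← Finset.mul_sum]
      linarith
    have hconv := convexOn_exp.2 (Set.mem_univ (∑ j, (2 * l * δ) * (y j).2 ^ 2))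
      (Set.mem_univ (4 * l * |T|)) (by norm_num : (0 : ℝ) ≤ 1 / 2)
      (by norm_num : (0 : ℝ) ≤ 1 / 2) (by norm_num)
    simp only [smul_eq_mul] at hconv
    have habs : Real.exp (4 * l * |T|) ≤ Real.exp (4 * l * T) + Real.exp (-(4 * l) * T) := by
      rcases abs_cases T with ⟨h, _⟩ | ⟨h, _⟩
      · rw [h]; linarith [Real.exp_pos (-(4 * l) * T)]
      · rw [h, mul_neg, ← neg_mul]; linarith [Real.exp_pos (4 * l * T)]
    have := (Real.exp_le_exp.2 htri).trans hconv
    linarith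
  refine (lintegral_mono hpt).trans ?_
  rw [lintegral_add_left (by fun_prop), lintegral_const_mul _ (by fun_prop),
    lintegral_const_mul _ (by fun_prop), lintegral_add_left (by fun_prop)]
  have h1 := lintegral_exp_diag_le hc.le (s := 2 * l * δ) (by positivity) hn (by linarith) ν hν
  have h2 := lintegral_exp_chaos_le ha hc.le hδ (t := 4 * l) hn
    (by rw [mul_assoc, hlc]; norm_num) ν hν
  have h3 := lintegral_exp_chaos_le ha hc.le hδ (t := -(4 * l)) hn
    (by rw [neg_mul, mul_assoc, hlc]; norm_num) ν hν
  calc _ ≤ ENNReal.ofReal (1 / 2) * ENNReal.ofReal (4 / 3)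
        + ENNReal.ofReal (1 / 2) * (ENNReal.ofReal (7 / 6) + ENNReal.ofReal (7 / 6)) := by gcongr
    _ = ENNReal.ofReal (11 / 6) := by
        rw [← ENNReal.ofReal_add (by norm_num) (by norm_num), ← ENNReal.ofReal_mul (by norm_num),
          ← ENNReal.ofReal_mul (by norm_num), ← ENNReal.ofReal_add (by norm_num) (by norm_num)]
        norm_num
    _ ≤ 2 := by
        rw [← ENNReal.ofReal_ofNat 2]
        exact ENNReal.ofReal_le_ofReal (by norm_num)

end Chaos

/-! ### Chaining -/

section Chaining

variable {Ω : Type*} [MeasurableSpace Ω] {μ : Measure Ω}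

/-- The maximum of `N` variables of `ψ₁` norm at most `b` has `ψ₁` norm at most
`b log (2 N) / log 2`. -/
theorem lintegral_exp_iSup_le [IsProbabilityMeasure μ] {ι : Type*} [Finite ι] [Nonempty ι]
    {Z : ι → Ω → ℝ} (hZ : ∀ i, Measurable (Z i)) {b : ℝ}
    (h : ∀ i, ∫⁻ ω, ENNReal.ofReal (Real.exp (Z i ω / b)) ∂μ ≤ 2) :
    ∫⁻ ω, ENNReal.ofReal (Real.exp ((⨆ i, Z i ω) /
      (b * (Real.log (2 * Nat.card ι) / Real.log 2)))) ∂μ ≤ 2 := by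
  have := Fintype.ofFinite ι
  have hN : (1 : ℝ) ≤ Nat.card ι := by exact_mod_cast Nat.card_pos
  have hlog2 : 0 < Real.log 2 := Real.log_pos one_lt_two
  have hlogN : Real.log 2 ≤ Real.log (2 * Nat.card ι) := Real.log_le_log two_pos (by linarith)
  -- The exponent `p` is chosen such that `(2 N) ^ p = 2`.
  set p : ℝ := Real.log 2 / Real.log (2 * Nat.card ι) with hp
  have hp0 : 0 < p := div_pos hlog2 (hlog2.trans_le hlogN)
  have hp1 : p ≤ 1 := div_le_one_of_le₀ hlogN (hlog2.trans_le hlogN).le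
  set G : Ω → ℝ≥0∞ := fun ω => ∑ i, ENNReal.ofReal (Real.exp (Z i ω / b)) with hG
  have hGm : Measurable G := Finset.measurable_sum _ fun i _ => by have := hZ i; fun_prop
  have hpt : ∀ ω, ENNReal.ofReal (Real.exp ((⨆ i, Z i ω) /
      (b * (Real.log (2 * Nat.card ι) / Real.log 2)))) ≤ G ω ^ p := by
    intro ω
    obtain ⟨i, hi⟩ := exists_eq_ciSup_of_finite (f := fun i => Z i ω)
    have h1 : (⨆ i, Z i ω) / (b * (Real.log (2 * Nat.card ι) / Real.log 2))
        = Z i ω / b * p := by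
      rw [← hi, hp, ← div_div, div_div_eq_mul_div, mul_div_assoc]
    rw [h1, Real.exp_mul, ← ENNReal.ofReal_rpow_of_pos (Real.exp_pos _)]
    refine ENNReal.rpow_le_rpow ?_ hp0.le
    exact Finset.single_le_sum (f := fun i => ENNReal.ofReal (Real.exp (Z i ω / b)))
      (fun _ _ => zero_le) (Finset.mem_univ i)
  have hGint : ∫⁻ ω, G ω ∂μ ≤ ENNReal.ofReal (2 * Nat.card ι) := by
    rw [lintegral_finsetSum _ fun i _ => by have := hZ i; fun_prop]
    refine (Finset.sum_le_sum fun i _ => h i).trans_eq ?_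
    rw [Finset.sum_const, Finset.card_univ, nsmul_eq_mul, ENNReal.ofReal_mul zero_le_two,
      ENNReal.ofReal_ofNat, ENNReal.ofReal_natCast, Nat.card_eq_fintype_card, mul_comm]
  -- Jensen's inequality for the concave power `p ≤ 1`, as monotonicity of `Lᵖ` norms.
  have hJ : ∫⁻ ω, G ω ^ p ∂μ ≤ (∫⁻ ω, G ω ∂μ) ^ p := by
    have := eLpNorm'_le_eLpNorm'_of_exponent_le hp0 hp1 μ hGm.aestronglyMeasurable
    simp only [eLpNorm', enorm_eq_self, ENNReal.rpow_one, div_one] at this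
    rwa [one_div, ENNReal.rpow_inv_le_iff hp0] at this
  calc _ ≤ ∫⁻ ω, G ω ^ p ∂μ := lintegral_mono hpt
    _ ≤ ENNReal.ofReal (2 * Nat.card ι) ^ p := hJ.trans (ENNReal.rpow_le_rpow hGint hp0.le)
    _ = 2 := by
        rw [ENNReal.ofReal_rpow_of_pos (by linarith), Real.rpow_def_of_pos (by linarith), hp,
          mul_div_cancel₀ _ (hlog2.trans_le hlogN).ne', Real.exp_log two_pos, ENNReal.ofReal_ofNat]

/-- The triangle inequality for the `ψ₁` norm, in terms of exponential moments. -/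
theorem lintegral_exp_sum_div_le [IsProbabilityMeasure μ] {m : ℕ} {M : ℕ → Ω → ℝ}
    (hM : ∀ k, Measurable (M k)) (hM0 : ∀ k ω, 0 ≤ M k ω) {b : ℕ → ℝ} (hb : ∀ k, 0 < b k)
    (h : ∀ k, ∫⁻ ω, ENNReal.ofReal (Real.exp (M k ω / b k)) ∂μ ≤ 2) {C : ℝ}
    (hC : ∑ k ∈ Finset.range m, b k ≤ C) :
    ∫⁻ ω, ENNReal.ofReal (Real.exp ((∑ k ∈ Finset.range m, M k ω) / C)) ∂μ ≤ 2 := by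
  rcases Nat.eq_zero_or_pos m with rfl | hm
  · simp
  set B := ∑ k ∈ Finset.range m, b k with hB
  have hB0 : 0 < B := Finset.sum_pos (fun k _ => hb k) (Finset.nonempty_range_iff.2 hm.ne')
  have hpt : ∀ ω, ENNReal.ofReal (Real.exp ((∑ k ∈ Finset.range m, M k ω) / C))
      ≤ ∑ k ∈ Finset.range m, ENNReal.ofReal (b k / B) *
        ENNReal.ofReal (Real.exp (M k ω / b k)) := by
    intro ω
    have h1 : (∑ k ∈ Finset.range m, M k ω) / C ≤ (∑ k ∈ Finset.range m, M k ω) / B :=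
      div_le_div_of_nonneg_left (Finset.sum_nonneg fun k _ => hM0 k ω) hB0 hC
    have h2 := convexOn_exp.map_sum_le (t := Finset.range m) (w := fun k => b k / B)
      (p := fun k => M k ω / b k) (fun k _ => (div_pos (hb k) hB0).le)
      (by rw [← Finset.sum_div, ← hB, div_self hB0.ne']) (fun _ _ => trivial)
    have h3 : ∑ k ∈ Finset.range m, (b k / B) • (M k ω / b k)
        = (∑ k ∈ Finset.range m, M k ω) / B := by
      rw [Finset.sum_div]
      refine Finset.sum_congr rfl fun k _ => ?_
      have := (hb k).ne'
      simp only [smul_eq_mul]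
      field_simp
    rw [h3] at h2
    refine (ENNReal.ofReal_le_ofReal ((Real.exp_le_exp.2 h1).trans h2)).trans_eq ?_
    simp only [smul_eq_mul]
    have hw : ∀ k, 0 ≤ b k / B := fun k => (div_pos (hb k) hB0).le
    rw [ENNReal.ofReal_sum_of_nonneg fun k _ => mul_nonneg (hw k) (Real.exp_pos _).le]
    exact Finset.sum_congr rfl fun k _ => ENNReal.ofReal_mul (hw k)
  refine (lintegral_mono hpt).trans ?_
  rw [lintegral_finsetSum _ fun k _ => by have := hM k; fun_prop]
  calc _ ≤ ∑ k ∈ Finset.range m, ENNReal.ofReal (b k / B) * 2 :=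
        Finset.sum_le_sum fun k _ => by
          rw [lintegral_const_mul _ (by have := hM k; fun_prop)]
          exact mul_le_mul_right (h k) _
    _ = 2 := by
        rw [← Finset.sum_mul, ← ENNReal.ofReal_sum_of_nonneg fun k _ => (div_pos (hb k) hB0).le,
          ← Finset.sum_div, ← hB, div_self hB0.ne', ENNReal.ofReal_one, one_mul]

variable {E : Type*} [PseudoMetricSpace E]

/-- The integral `∫_0^{D/2} log (2 N(a, L)) da` over the diameter `D` of `L`. -/
noncomputable def entropyIntegral (L : Set E) : ℝ≥0∞ :=
  ∫⁻ a in Set.Ioc (0 : ℝ) (Metric.diam L / 2),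
    (ENNReal.log (2 * (Metric.coveringNumber a.toNNReal L : ℝ≥0∞))).toENNReal

/-- Comparison of the entropy integral with its dyadic lower sums. -/
theorem sum_le_entropyIntegral (L : Set E) (m : ℕ) :
    ∑ k ∈ Finset.range m, ENNReal.ofReal (Metric.diam L / 2 ^ (k + 2)) *
      (ENNReal.log (2 * (Metric.coveringNumber
        (Metric.diam L / 2 ^ (k + 1)).toNNReal L : ℝ≥0∞))).toENNReal
      ≤ entropyIntegral L := by
  set D := Metric.diam L
  have hD : 0 ≤ D := Metric.diam_nonneg
  set φ : ℝ → ℝ≥0∞ := fun a =>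
    (ENNReal.log (2 * (Metric.coveringNumber a.toNNReal L : ℝ≥0∞))).toENNReal
  have hφ : Antitone φ := by
    intro a b hab
    refine EReal.toENNReal_le_toENNReal (ENNReal.log_monotone ?_)
    have := Metric.coveringNumber_anti (A := L) (Real.toNNReal_le_toNNReal hab)
    gcongr
  suffices h : ∑ k ∈ Finset.range m, ENNReal.ofReal (D / 2 ^ (k + 2)) * φ (D / 2 ^ (k + 1))
      ≤ ∫⁻ a in Set.Ioc (D / 2 ^ (m + 1)) (D / 2), φ a from
    h.trans (lintegral_mono_set (Set.Ioc_subset_Ioc_left (by positivity)))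
  induction m with
  | zero => simp
  | succ m ih =>
    have hle : D / 2 ^ (m + 2) ≤ D / 2 ^ (m + 1) :=
      div_le_div_of_nonneg_left hD (by positivity) (by gcongr <;> norm_num)
    have hle' : D / 2 ^ (m + 1) ≤ D / 2 :=
      div_le_div_of_nonneg_left hD two_pos (le_self_pow₀ one_le_two (by omega))
    rw [Finset.sum_range_succ, ← Set.Ioc_union_Ioc_eq_Ioc hle hle',
      lintegral_union measurableSet_Ioc (by
        rw [Set.disjoint_left]; intro x hx hx'; exact absurd hx.2 (not_le.2 hx'.1)), add_comm]
    refine add_le_add ?_ ih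
    calc ENNReal.ofReal (D / 2 ^ (m + 2)) * φ (D / 2 ^ (m + 1))
        = ∫⁻ _ in Set.Ioc (D / 2 ^ (m + 2)) (D / 2 ^ (m + 1)), φ (D / 2 ^ (m + 1)) := by
          rw [setLIntegral_const, Real.volume_Ioc, mul_comm]
          congr 2
          field_simp
          ring
      _ ≤ _ := setLIntegral_mono' measurableSet_Ioc fun a ha => hφ ha.2

theorem coveringNumber_ne_top_of_entropyIntegral {L : Set E} (hD : 0 < Metric.diam L)
    (hI : entropyIntegral L ≠ ⊤) (k : ℕ) :
    Metric.coveringNumber (Metric.diam L / 2 ^ (k + 1)).toNNReal L ≠ ⊤ := by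
  intro h
  refine hI (top_le_iff.1 (le_trans ?_ (sum_le_entropyIntegral L (k + 1))))
  refine le_trans (le_of_eq ?_) (Finset.single_le_sum (fun _ _ => zero_le)
    (Finset.self_mem_range_succ k))
  rw [h]
  have : ENNReal.ofReal (Metric.diam L / 2 ^ (k + 2)) ≠ 0 := by
    rw [ne_eq, ENNReal.ofReal_eq_zero, not_le]; positivity
  simp [ENNReal.mul_top, this]

/-- Dudley's chaining bound for a process with `ψ₁` increments that vanishes at a point `o`. The
chain of `f` runs through minimal nets of radii `D / 2 ^ k`, the coarsest being `{o}`; each point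
of a net is linked to a nearest point of the next coarser one, so that there are only as many links
at a level as there are points in its net. -/
theorem lintegral_exp_iSup_process_le [IsProbabilityMeasure μ] {L : Set E} {W : E → Ω → ℝ}
    (hbdd : Bornology.IsBounded L) (hD : 0 < Metric.diam L) (hI : entropyIntegral L ≠ ⊤)
    (hW : ∀ f ∈ L, Measurable (W f)) {K : Ω → ℝ}
    (hK : ∀ f g ω, |W f ω - W g ω| ≤ K ω * dist f g)
    {o : E} (ho : o ∈ L) (hWo : ∀ ω, W o ω = 0) {κ : ℝ} (hκ : 0 < κ)
    (hinc : ∀ f ∈ L, ∀ g ∈ L, ∀ δ : ℝ, 0 < δ → dist f g ≤ δ →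
      ∫⁻ ω, ENNReal.ofReal (Real.exp (|W f ω - W g ω| / (κ * δ))) ∂μ ≤ 2)
    {C : ℝ} (hC : 0 < C) (hCI : 4 / Real.log 2 * κ * (entropyIntegral L).toReal ≤ C) :
    ∫⁻ ω, ENNReal.ofReal (Real.exp ((⨆ f : L, W f ω) / C)) ∂μ ≤ 2 := by
  set D := Metric.diam L with hDdef
  set r : ℕ → ℝ := fun k => D / 2 ^ k with hr
  have hr0 : ∀ k, 0 < r k := fun k => by simp only [hr]; positivity
  set A : ℕ → Set E := fun k => if k = 0 then {o} else Metric.minimalCover (r k).toNNReal L with hA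
  have hA0 : A 0 = {o} := by simp [hA]
  have hAs : ∀ k, A (k + 1) = Metric.minimalCover (r (k + 1)).toNNReal L := fun k => by simp [hA]
  have hfin : ∀ k, Metric.coveringNumber (r (k + 1)).toNNReal L ≠ ⊤ :=
    coveringNumber_ne_top_of_entropyIntegral hD hI
  have hAL : ∀ k, A k ⊆ L := by
    intro k
    cases k with
    | zero => simpa [hA0] using ho
    | succ k => rw [hAs]; exact Metric.minimalCover_subset
  have hcover : ∀ k, ∀ f ∈ L, ∃ g ∈ A k, dist f g ≤ r k := by
    intro k f hf
    cases k with
    | zero =>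
      refine ⟨o, by simp [hA0], ?_⟩
      simpa [hr] using Metric.dist_le_diam_of_mem hbdd hf ho
    | succ k =>
      have h := (Metric.isCover_minimalCover (hfin k)).subset_iUnion_closedBall hf
      simp only [Set.mem_iUnion, Metric.mem_closedBall, Real.coe_toNNReal _ (hr0 _).le] at h
      obtain ⟨g, hg, hd⟩ := h
      exact ⟨g, by rw [hAs]; exact hg, hd⟩
  have hπ : ∀ k, ∃ p : E → E, ∀ f ∈ L, p f ∈ A k ∧ dist f (p f) ≤ r k := by
    intro k
    have : ∀ f : E, ∃ g, f ∈ L → g ∈ A k ∧ dist f g ≤ r k := fun f => by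
      by_cases hf : f ∈ L
      · obtain ⟨g, hg⟩ := hcover k f hf
        exact ⟨g, fun _ => hg⟩
      · exact ⟨f, fun h => absurd h hf⟩
    choose p hp using this
    exact ⟨p, hp⟩
  choose π hπA hπd using hπ
  have hfinA : ∀ k, Finite (A (k + 1)) := fun k => by
    rw [hAs]; exact Metric.finite_minimalCover.to_subtype
  have hneA : ∀ k, Nonempty (A (k + 1)) := fun k => by
    obtain ⟨g, hg, _⟩ := hcover (k + 1) o ho
    exact ⟨⟨g, hg⟩⟩
  -- The largest link between the nets of levels `k + 1` and `k`.
  set M : ℕ → Ω → ℝ := fun k ω => ⨆ f : A (k + 1), |W f ω - W (π k f) ω| with hM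
  have hlink : ∀ k, ∀ f ∈ A (k + 1), ∀ ω, |W f ω - W (π k f) ω| ≤ M k ω := fun k f hf ω =>
    le_ciSup (f := fun f : A (k + 1) => |W f ω - W (π k f) ω|)
      (Set.finite_range _).bddAbove ⟨f, hf⟩
  have hM0 : ∀ k ω, 0 ≤ M k ω := fun k ω => Real.iSup_nonneg fun _ => abs_nonneg _
  have hlinkm : ∀ k, ∀ f : A (k + 1), Measurable fun ω => |W f ω - W (π k f) ω| := fun k f =>
    ((hW _ (hAL _ f.2)).sub (hW _ (hAL _ (hπA k _ (hAL _ f.2))))).abs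
  have hMm : ∀ k, Measurable (M k) := fun k => Measurable.iSup (hlinkm k)
  have hcard : ∀ k, ((Nat.card (A (k + 1)) : ℕ) : ℝ≥0∞)
      = (Metric.coveringNumber (r (k + 1)).toNNReal L : ℝ≥0∞) := fun k => by
    have h1 := Metric.encard_minimalCover (hfin k)
    rw [← hAs k, Set.encard, ENat.card_eq_coe_natCard] at h1
    rw [← h1]
    exact (ENat.toENNReal_coe _).symm
  have hcard1 : ∀ k, (1 : ℝ) ≤ Nat.card (A (k + 1)) := fun k => by
    exact_mod_cast Nat.card_pos
  have hlog2 : 0 < Real.log 2 := Real.log_pos one_lt_two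
  have hlogc : ∀ k, 0 < Real.log (2 * Nat.card (A (k + 1))) := fun k =>
    Real.log_pos (by linarith [hcard1 k])
  set b : ℕ → ℝ := fun k => κ * r k * (Real.log (2 * Nat.card (A (k + 1))) / Real.log 2) with hb
  have hb0 : ∀ k, 0 < b k := fun k =>
    mul_pos (mul_pos hκ (hr0 k)) (div_pos (hlogc k) hlog2)
  have hMb : ∀ k, ∫⁻ ω, ENNReal.ofReal (Real.exp (M k ω / b k)) ∂μ ≤ 2 := fun k =>
    lintegral_exp_iSup_le (hlinkm k) fun f =>
      hinc _ (hAL _ f.2) _ (hAL _ (hπA k _ (hAL _ f.2))) _ (hr0 k) (hπd k _ (hAL _ f.2))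
  have hbC : ∀ m, ∑ k ∈ Finset.range m, b k ≤ C := by
    intro m
    refine le_trans ?_ hCI
    have hsum := sum_le_entropyIntegral L m
    have hterm : ∀ k, ENNReal.ofReal (D / 2 ^ (k + 2)) * (ENNReal.log (2 *
        (Metric.coveringNumber (D / 2 ^ (k + 1)).toNNReal L : ℝ≥0∞))).toENNReal
        = ENNReal.ofReal (D / 2 ^ (k + 2) * Real.log (2 * Nat.card (A (k + 1)))) := by
      intro k
      have h2 : (2 * (Metric.coveringNumber (D / 2 ^ (k + 1)).toNNReal L : ℝ≥0∞))
          = ENNReal.ofReal (2 * Nat.card (A (k + 1))) := by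
        rw [ENNReal.ofReal_mul zero_le_two, ENNReal.ofReal_ofNat, ENNReal.ofReal_natCast]
        rw [hcard k]
      rw [h2, ENNReal.log_ofReal_of_pos (by linarith [hcard1 k]),
        EReal.toENNReal_of_ne_top (EReal.coe_ne_top _), EReal.toReal_coe,
        ENNReal.ofReal_mul (by positivity)]
    rw [← hDdef] at hsum
    simp_rw [hterm] at hsum
    have hnn : ∀ k, 0 ≤ D / 2 ^ (k + 2) * Real.log (2 * Nat.card (A (k + 1))) := fun k =>
      mul_nonneg (by positivity) (hlogc k).le
    rw [← ENNReal.ofReal_sum_of_nonneg fun k _ => hnn k, ENNReal.ofReal_le_iff_le_toReal hI] at hsum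
    calc ∑ k ∈ Finset.range m, b k
        = 4 / Real.log 2 * κ *
          ∑ k ∈ Finset.range m, D / 2 ^ (k + 2) * Real.log (2 * Nat.card (A (k + 1))) := by
          rw [Finset.mul_sum]
          refine Finset.sum_congr rfl fun k _ => ?_
          simp only [hb, hr, pow_add]
          field_simp
          ring
      _ ≤ _ := mul_le_mul_of_nonneg_left hsum (by positivity)
  set T : ℕ → Ω → ℝ := fun m ω => ∑ k ∈ Finset.range m, M k ω with hT
  have hchain : ∀ m, ∀ f ∈ A m, ∀ ω, W f ω ≤ T m ω := by
    intro m
    induction m with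
    | zero =>
      intro f hf ω
      rw [hA0, Set.mem_singleton_iff] at hf
      simp [hT, hf, hWo]
    | succ m ih =>
      intro f hf ω
      have h1 := ih _ (hπA m f (hAL _ hf)) ω
      have h2 := (le_abs_self _).trans (hlink m f hf ω)
      simp only [hT, Finset.sum_range_succ] at h1 ⊢
      linarith
  have hT1 : ∀ m, ∫⁻ ω, ENNReal.ofReal (Real.exp (T m ω / C)) ∂μ ≤ 2 := fun m =>
    lintegral_exp_sum_div_le hMm hM0 hb0 hMb (hbC m)
  have hTm : ∀ m, Measurable (T m) := fun m => Finset.measurable_sum _ fun k _ => hMm k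
  have hTmono : ∀ ω, Monotone fun m => T m ω := fun ω =>
    monotone_nat_of_le_succ fun m => by
      simp only [hT, Finset.sum_range_succ]
      linarith [hM0 m ω]
  have : Nonempty L := ⟨⟨o, ho⟩⟩
  have hsup : ∀ m ω, (⨆ f : L, W f ω) ≤ T m ω + |K ω| * r m := by
    intro m ω
    refine ciSup_le fun f => ?_
    have h1 := hchain m _ (hπA m f f.2) ω
    have h2 := (le_abs_self _).trans (hK f (π m f) ω)
    have h3 : K ω * dist (f : E) (π m f) ≤ |K ω| * r m :=
      mul_le_mul (le_abs_self _) (hπd m f f.2) dist_nonneg (abs_nonneg _)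
    linarith
  have hpt : ∀ ω, ENNReal.ofReal (Real.exp ((⨆ f : L, W f ω) / C))
      ≤ ⨆ m, ENNReal.ofReal (Real.exp (T m ω / C)) := by
    intro ω
    have hrlim : Filter.Tendsto r Filter.atTop (nhds 0) := by
      have := (tendsto_pow_atTop_nhds_zero_of_lt_one (r := (1 / 2 : ℝ)) (by norm_num)
        (by norm_num)).const_mul D
      simpa [hr, div_eq_mul_inv] using this
    have hcont : Continuous fun x : ℝ =>
        ENNReal.ofReal (Real.exp (((⨆ f : L, W f ω) - |K ω| * x) / C)) :=
      ENNReal.continuous_ofReal.comp (by fun_prop)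
    have hlim := (hcont.tendsto 0).comp hrlim
    simp only [mul_zero, sub_zero] at hlim
    refine le_of_tendsto' hlim fun m => le_trans ?_ (le_iSup _ m)
    refine ENNReal.ofReal_le_ofReal (Real.exp_le_exp.2 ?_)
    exact div_le_div_of_nonneg_right (by linarith [hsup m ω]) hC.le
  refine (lintegral_mono hpt).trans ?_
  rw [lintegral_iSup (fun m => by have := hTm m; fun_prop) fun m m' hmm ω =>
    ENNReal.ofReal_le_ofReal (Real.exp_le_exp.2 (div_le_div_of_nonneg_right (hTmono ω hmm) hC.le))]
  exact iSup_le hT1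

end Chaining

/-! ### Orlicz norms and the increments of the process -/

section Orlicz

variable {Ω : Type*} [MeasurableSpace Ω] {μ : Measure Ω}

/-- The condition `E ψ₁ (Z / C) ≤ 1` amounts to `E exp (|Z| / C) ≤ 2`, the form in which bounds on
`ψ₁` norms are proved here. -/
theorem psiOneNorm_le_of_lintegral_exp_le [IsProbabilityMeasure μ] {Z : Ω → ℝ} {C : ℝ}
    (hC : 0 < C) (h : ∫⁻ ω, ENNReal.ofReal (Real.exp (|Z ω| / C)) ∂μ ≤ 2) :
    psiOneNorm Z μ ≤ ENNReal.ofReal C := by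
  refine sInf_le ⟨C, ⟨hC, ?_⟩, rfl⟩
  have h1 : ∀ ω, ENNReal.ofReal (psiOne (Z ω / C)) + 1
      = ENNReal.ofReal (Real.exp (|Z ω| / C)) := by
    intro ω
    rw [psiOne, abs_div, abs_of_pos hC, ← ENNReal.ofReal_one, ← ENNReal.ofReal_add
      (sub_nonneg.2 (Real.one_le_exp (div_nonneg (abs_nonneg _) hC.le))) zero_le_one,
      sub_add_cancel]
  have h2 : ∫⁻ ω, ENNReal.ofReal (psiOne (Z ω / C)) ∂μ + 1 ≤ 1 + 1 := by
    have : ∫⁻ ω, (ENNReal.ofReal (psiOne (Z ω / C)) + 1) ∂μ ≤ 1 + 1 := by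
      simp_rw [h1]
      exact h.trans_eq one_add_one_eq_two.symm
    rwa [lintegral_add_right _ measurable_const, lintegral_const, measure_univ, one_mul] at this
  exact (ENNReal.add_le_add_iff_right ENNReal.one_ne_top).1 h2

theorem psiOneNorm_eq_zero_of_ae_eq_zero {Z : Ω → ℝ} (h : ∀ᵐ ω ∂μ, Z ω = 0) :
    psiOneNorm Z μ = 0 := by
  refine le_antisymm (ENNReal.le_of_forall_pos_le_add fun a ha _ => ?_) zero_le
  rw [zero_add, ← ENNReal.ofReal_coe_nnreal]
  refine sInf_le ⟨a, ⟨by exact_mod_cast ha, ?_⟩, rfl⟩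
  rw [lintegral_congr_ae (g := fun _ => 0) (h.mono fun ω hω => by simp [hω, psiOne])]
  simp

end Orlicz

/-- A variable that is `0`-subgaussian vanishes almost surely, because
`exp u + exp (-u) - 2` is nonnegative with expectation at most `0`, and vanishes only at `0`. -/
theorem CondSubgaussian.ae_eq_zero {Ω S : Type*} [MeasurableSpace Ω] [MeasurableSpace S]
    {μ : Measure Ω} [IsProbabilityMeasure μ] {X : Ω → S} {ε : Ω → ℝ}
    (h : CondSubgaussian ε X 0 μ) (hX : Measurable X) : ∀ᵐ ω ∂μ, ε ω = 0 := by
  have hle : ∀ t : ℝ, ∫ ω, Real.exp (t * ε ω) ∂μ ≤ 1 := by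
    intro t
    rw [← integral_condExp hX.comap_le]
    refine (integral_mono_ae integrable_condExp (integrable_const _) (h.condExp_le t)).trans ?_
    simp
  have hnn : ∀ u : ℝ, 1 ≤ Real.cosh u := Real.one_le_cosh
  have hg : ∀ ω, Real.exp (1 * ε ω) + Real.exp (-1 * ε ω) - 2 = 2 * (Real.cosh (ε ω) - 1) := by
    intro ω
    rw [Real.cosh_eq]
    ring_nf
  have hint : Integrable (fun ω => Real.exp (1 * ε ω) + Real.exp (-1 * ε ω) - 2) μ :=
    ((h.integrable_exp 1).add (h.integrable_exp (-1))).sub (integrable_const 2)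
  have hpos : 0 ≤ fun ω => Real.exp (1 * ε ω) + Real.exp (-1 * ε ω) - 2 := fun ω => by
    simp only [hg, Pi.zero_apply]
    linarith [hnn (ε ω)]
  have hzero : ∫ ω, (Real.exp (1 * ε ω) + Real.exp (-1 * ε ω) - 2) ∂μ = 0 := by
    refine le_antisymm ?_ (integral_nonneg hpos)
    have hadd : Integrable (fun ω => Real.exp (1 * ε ω) + Real.exp (-1 * ε ω)) μ :=
      (h.integrable_exp 1).add (h.integrable_exp (-1))
    rw [integral_sub hadd (integrable_const 2),
      integral_add (h.integrable_exp 1) (h.integrable_exp (-1))]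
    have h1 := hle 1
    have h2 := hle (-1)
    simp only [integral_const, probReal_univ, smul_eq_mul]
    linarith
  filter_upwards [(integral_eq_zero_iff_of_nonneg hpos hint).1 hzero] with ω hω
  by_contra hne
  have := Real.one_lt_cosh.2 hne
  rw [hg] at hω
  simp only [Pi.zero_apply] at hω
  linarith

/-- The increments of `f ↦ quadForm X ε f` over kernels have `ψ₁` norm at most
`16 c / n` times the uniform distance. -/
theorem lintegral_exp_quadForm_sub_le {Ω S : Type*} [MeasurableSpace Ω] {μ : Measure Ω}
    [IsProbabilityMeasure μ] [TopologicalSpace S] [TopologicalSpace.SeparableSpace S]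
    [MeasurableSpace S] [OpensMeasurableSpace S] {n : ℕ} (hn : 0 < n) {c : ℝ} (hc : 0 < c)
    {X : Fin n → Ω → S} {ε : Fin n → Ω → ℝ}
    (hX : ∀ i, Measurable (X i)) (hε : ∀ i, Measurable (ε i))
    (h_indep : iIndepFun (fun i ω => (X i ω, ε i ω)) μ)
    (h_subg : ∀ i, CondSubgaussian (ε i) (X i) c μ)
    {f g : S × S →ᵇ ℝ} (hf : IsKernel f) (hg : IsKernel g) {δ : ℝ} (hδ0 : 0 < δ)
    (hδ : dist f g ≤ δ) :
    ∫⁻ ω, ENNReal.ofReal (Real.exp (|quadForm X ε f ω - quadForm X ε g ω|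
      / (16 * c / n * δ))) ∂μ ≤ 2 := by
  have hY : ∀ i, Measurable fun ω => (X i ω, ε i ω) := fun i => (hX i).prodMk (hε i)
  have hn' : (0 : ℝ) < n := by exact_mod_cast hn
  set a : S × S → ℝ := fun p => f p - g p with ha
  have ham : Measurable a := hf.measurable.sub hg.measurable
  have hlaw := (iIndepFun_iff_map_fun_eq_pi_map fun i => (hY i).aemeasurable).1 h_indep
  have : ∀ i, IsProbabilityMeasure (μ.map fun ω => (X i ω, ε i ω)) := fun i =>
    Measure.isProbabilityMeasure_map (hY i).aemeasurable
  have hmain := lintegral_exp_quadratic_le ham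
    (fun x x' => by simp only [ha, hf.symm x x', hg.symm x x']) hc hδ0
    (fun p => (f.dist_coe_le_dist (g := g) p).trans hδ) hn
    (fun i => μ.map fun ω => (X i ω, ε i ω))
    fun i => (h_subg i).fiberSubgaussian (hX i) (hε i)
  rw [← hlaw, lintegral_map (by fun_prop) (measurable_pi_lambda _ hY)] at hmain
  refine le_trans (le_of_eq (lintegral_congr fun ω => ?_)) hmain
  rw [quadForm_sub, abs_mul, abs_of_nonneg (by positivity)]
  congr 2
  field_simp
  rfl

theorem entropyConst_sq {S : Type*} [TopologicalSpace S] (L : Set (S × S →ᵇ ℝ)) :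
    entropyConst L ^ 2 = 162 * entropyIntegral L + 1 := by
  rw [entropyConst, ← ENNReal.rpow_natCast, ← ENNReal.rpow_mul]
  norm_num
  rfl

end KernelChaining

theorem mainTheorem9
    {Ω S : Type*} [MeasurableSpace Ω] (μ : Measure Ω) [IsProbabilityMeasure μ]
    [TopologicalSpace S] [TopologicalSpace.SeparableSpace S]
    [MeasurableSpace S] [OpensMeasurableSpace S]
    (𝒦 : Set (S × S →ᵇ ℝ))
    (h𝒦_kernel : ∀ k ∈ 𝒦, KernelChaining.IsKernel k)
    (h𝒦_sep : TopologicalSpace.IsSeparable 𝒦)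
    (n : ℕ) (hn : 0 < n) (σ : ℝ)
    (X : Fin n → Ω → S) (ε : Fin n → Ω → ℝ)
    (hX : ∀ i, Measurable (X i)) (hε : ∀ i, Measurable (ε i))
    (h_indep : iIndepFun (fun i ω => (X i ω, ε i ω)) μ)
    (h_ident : ∀ i j,
      IdentDistrib (fun ω => (X i ω, ε i ω)) (fun ω => (X j ω, ε j ω)) μ μ)
    (h_subg : ∀ i, KernelChaining.CondSubgaussian (ε i) (X i) (σ ^ 2) μ) :
    (∀ ω, BddAbove
      (Set.range fun f : KernelChaining.normalisedClass 𝒦 => KernelChaining.quadForm X ε f ω)) ∧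
    Measurable (fun ω =>
      ⨆ f : KernelChaining.normalisedClass 𝒦, KernelChaining.quadForm X ε f ω) ∧
    KernelChaining.psiOneNorm (fun ω =>
      ⨆ f : KernelChaining.normalisedClass 𝒦, KernelChaining.quadForm X ε f ω) μ
      ≤ 4 * KernelChaining.entropyConst (KernelChaining.normalisedClass 𝒦) ^ 2
          * ENNReal.ofReal (σ ^ 2) / (n : ℝ≥0∞) := by
  open KernelChaining in
  have hbdd := bddAbove_quadForm X ε h𝒦_kernel
  refine ⟨hbdd, measurable_iSup_quadForm X ε h𝒦_kernel h𝒦_sep hX hε, ?_⟩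
  set L := normalisedClass 𝒦 with hL
  have hn' : (0 : ℝ) < n := by exact_mod_cast hn
  -- For `σ = 0` the bound is `0` even if the entropy integral is infinite, so that it has to come
  -- from the noise itself.
  by_cases hσ : σ ^ 2 = 0
  · rw [hσ] at h_subg
    have hae : ∀ᵐ ω ∂μ, ∀ i, ε i ω = 0 := ae_all_iff.2 fun i => (h_subg i).ae_eq_zero (hX i)
    rw [psiOneNorm_eq_zero_of_ae_eq_zero]
    · exact zero_le
    filter_upwards [hae] with ω hω
    simp [quadForm, hω]
  have hc : 0 < σ ^ 2 := lt_of_le_of_ne (sq_nonneg σ) (Ne.symm hσ)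
  rcases (Metric.diam_nonneg (s := L)).eq_or_lt with hD | hD
  · -- If the class has diameter `0`, it consists of the zero function only.
    rw [psiOneNorm_eq_zero_of_ae_eq_zero]
    · exact zero_le
    refine Filter.Eventually.of_forall fun ω => ?_
    have hz : ∀ f : L, quadForm X ε f ω = 0 := fun f => by
      have := Metric.dist_le_diam_of_mem (isBounded_normalisedClass h𝒦_kernel) f.2
        zero_mem_normalisedClass
      rw [← hL, ← hD] at this
      rw [dist_le_zero.1 this, quadForm_zero]
    simp [hz]
  rw [entropyConst_sq]
  by_cases hI : entropyIntegral L = ⊤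
  · have h0 : ENNReal.ofReal (σ ^ 2) ≠ 0 := (ENNReal.ofReal_pos.2 hc).ne'
    rw [hI]
    have : (4 * (162 * ⊤ + 1) * ENNReal.ofReal (σ ^ 2) / (n : ℝ≥0∞) : ℝ≥0∞) = ⊤ := by
      rw [ENNReal.mul_top (by norm_num), top_add, ENNReal.mul_top (by norm_num),
        ENNReal.top_mul h0, ENNReal.top_div_of_ne_top (ENNReal.natCast_ne_top n)]
    rw [this]
    exact le_top
  set I := (entropyIntegral L).toReal with hIdef
  have hI0 : 0 ≤ I := ENNReal.toReal_nonneg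
  set C : ℝ := 4 * (162 * I + 1) * σ ^ 2 / n with hC
  have hC0 : 0 < C := by positivity
  have hCE : (4 * (162 * entropyIntegral L + 1) * ENNReal.ofReal (σ ^ 2) / (n : ℝ≥0∞) : ℝ≥0∞)
      = ENNReal.ofReal C := by
    rw [hC, ENNReal.ofReal_div_of_pos hn', ENNReal.ofReal_mul (by positivity),
      ENNReal.ofReal_mul (by positivity), ENNReal.ofReal_add (by positivity) zero_le_one,
      ENNReal.ofReal_mul (by positivity), hIdef, ENNReal.ofReal_toReal hI]
    simp
  have hCI : 4 / Real.log 2 * (16 * σ ^ 2 / n) * I ≤ C := by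
    have h1 : 4 / Real.log 2 * 16 ≤ 648 := by
      have := Real.log_two_gt_d9
      rw [div_mul_eq_mul_div, div_le_iff₀ (by linarith)]
      linarith
    have h2 : 4 / Real.log 2 * (16 * σ ^ 2 / n) * I
        = 4 / Real.log 2 * 16 * (σ ^ 2 / n * I) := by ring
    have h3 : C = 648 * (σ ^ 2 / n * I) + 4 * (σ ^ 2 / n) := by rw [hC]; ring
    rw [h2, h3]
    have h4 : 0 ≤ σ ^ 2 / n * I := by positivity
    have h5 : 0 ≤ 4 * (σ ^ 2 / n) := by positivity
    linarith [mul_le_mul_of_nonneg_right h1 h4]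
  rw [hCE]
  refine psiOneNorm_le_of_lintegral_exp_le hC0 ?_
  have hsup0 : ∀ ω, 0 ≤ ⨆ f : L, quadForm X ε f ω := fun ω =>
    (quadForm_zero X ε ω).symm.le.trans
      (le_ciSup (hbdd ω) ⟨0, zero_mem_normalisedClass⟩)
  simp_rw [abs_of_nonneg (hsup0 _)]
  exact lintegral_exp_iSup_process_le (W := quadForm X ε) (isBounded_normalisedClass h𝒦_kernel)
    hD hI
    (fun f hf => measurable_quadForm X ε hX hε
      (isKernel_of_mem_normalisedClass h𝒦_kernel hf).measurable)
    (abs_quadForm_sub_le X ε) zero_mem_normalisedClass (quadForm_zero X ε)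
    (κ := 16 * σ ^ 2 / n) (by positivity)
    (fun f hf g hg δ hδ0 hδ => lintegral_exp_quadForm_sub_le hn hc hX hε h_indep h_subg
      (isKernel_of_mem_normalisedClass h𝒦_kernel hf)
      (isKernel_of_mem_normalisedClass h𝒦_kernel hg) hδ0 hδ)
    hC0 hCI
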